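/- Let $G$ be a finite simple graph in which every vertex has degree $1$ or $3$. A pendent vertex is a vertex of degree $1$, and a pendent edge is an edge incident with a pendent vertex. Suppose that $G$ has at least one pendent vertex, and that the graph obtained from $G$ by deleting all its pendent vertices is either the one-vertex graph $K_1$ or 2-connected (it has at least three vertices, is connected, and remains connected after the deletion of any single vertex). An incidence of $G$ is a pair $(u,e)$ of a vertex $u$ and an edge $e$ of $G$ with $u$ an endpoint of $e$. Two distinct incidences $(u,e)$ and $(v,f)$ are adjacent if $u=v$, or $e=f$, or $uv=e$, or $uv=f$. Let $L$ assign to each incidence $(u,e)$ of $G$ a set $L(u,e)$ of exactly $6$ colors. An incidence $L$-coloring is a function $\varphi$ on the incidences of $G$ such that $\varphi(u,e)\in L(u,e)$ for every incidence $(u,e)$ and adjacent incidences receive distinct colors. Then every pendent edge $e=uv$ of $G$ is freely $L$-choosable: for all distinct colors $c_1\in L(u,e)$ and $c_2\in L(v,e)$ there is an incidence $L$-coloring $\varphi$ of $G$ with $\varphi(u,e)=c_1$ and $\varphi(v,e)=c_2$. -/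

import Mathlib

namespace IncidenceColoring

variable {V : Type*} {C : Type*}

/-- An incidence of `G`: a pair `(u, e)` of a vertex `u` and an edge `e` of `G` such that
`u` is an endpoint of `e`. -/
@[ext]
structure Incidence (G : SimpleGraph V) where
  vertex : V
  edge : Sym2 V
  edge_mem : edge ∈ G.edgeSet
  vertex_mem : vertex ∈ edge

/-- Two distinct incidences `(u, e)` and `(v, f)` are adjacent if `u = v`, or `e = f`,
or `uv = e`, or `uv = f`. -/
def Incidence.Adj {G : SimpleGraph V} (a b : Incidence G) : Prop :=
  a ≠ b ∧ (a.vertex = b.vertex ∨ a.edge = b.edge ∨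
    s(a.vertex, b.vertex) = a.edge ∨ s(a.vertex, b.vertex) = b.edge)

/-- `φ` is an incidence coloring of `G`. -/
def IsColoring (G : SimpleGraph V) (φ : Incidence G → C) : Prop :=
  ∀ a b : Incidence G, a.Adj b → φ a ≠ φ b

/-- `φ` is an incidence `L`-coloring of `G`. -/
def IsListColoring (G : SimpleGraph V) (L : Incidence G → Finset C)
    (φ : Incidence G → C) : Prop :=
  IsColoring G φ ∧ ∀ a : Incidence G, φ a ∈ L a

/-- `L` is an incidence `k`-list assignment of `G`. -/
def IsListAssignment (G : SimpleGraph V) (k : ℕ) (L : Incidence G → Finset C) : Prop :=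
  ∀ a : Incidence G, (L a).card = k

/-- The edge `e = uv` of `G` is freely `L`-choosable: for all distinct colors `c₁ ∈ L(u, e)` and
`c₂ ∈ L(v, e)` there is an incidence `L`-coloring `φ` with `φ(u, e) = c₁` and `φ(v, e) = c₂`.
Here `a` and `b` are the two incidences `(u, e)` and `(v, e)` on `e`. -/
def FreelyChoosable (G : SimpleGraph V) (L : Incidence G → Finset C) (e : Sym2 V) : Prop :=
  e ∈ G.edgeSet ∧
    ∀ a b : Incidence G, a.edge = e → b.edge = e → a.vertex ≠ b.vertex →
      ∀ c₁ ∈ L a, ∀ c₂ ∈ L b, c₁ ≠ c₂ →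
        ∃ φ : Incidence G → C, IsListColoring G L φ ∧ φ a = c₁ ∧ φ b = c₂

/-- Every vertex has degree 1 or 3. -/
def IsSemicubic (G : SimpleGraph V) [G.LocallyFinite] : Prop :=
  ∀ v : V, G.degree v = 1 ∨ G.degree v = 3

/-- A pendent vertex is a vertex of degree 1. -/
def IsPendentVertex (G : SimpleGraph V) [G.LocallyFinite] (v : V) : Prop :=
  G.degree v = 1

/-- A pendent edge is an edge with a pendent endpoint. -/
def IsPendentEdge (G : SimpleGraph V) [G.LocallyFinite] (e : Sym2 V) : Prop :=
  e ∈ G.edgeSet ∧ ∃ v ∈ e, IsPendentVertex G v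

/-- The graph obtained from `G` by deleting all pendent vertices of `G`. -/
def deletePendent (G : SimpleGraph V) [G.LocallyFinite] :
    SimpleGraph {v : V | ¬ IsPendentVertex G v} :=
  G.induce {v : V | ¬ IsPendentVertex G v}

/-- A graph is 2-connected if it has at least three vertices, is connected, and
stays connected after the deletion of any one vertex. -/
def IsTwoConnected (G : SimpleGraph V) : Prop :=
  3 ≤ ENat.card V ∧ G.Connected ∧ ∀ v : V, (G.induce {v}ᶜ).Connected

/-- `G` is the one-vertex graph `K₁`. -/
def IsK1 (G : SimpleGraph V) : Prop :=
  Nonempty (G ≃g SimpleGraph.completeGraph (Fin 1))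

end IncidenceColoring

/-! Write the color of the incidence `(u, uv)` as `φ u v`. A coloring is proper exactly when the
colors leaving each vertex are distinct and `φ u v` is not among the at most three colors leaving
`v`. With lists of size six, a pendent vertex can therefore always be colored, and a vertex of
degree 3 can be colored greedily as long as one of its neighbors is still uncolored: in a suitable
order its three incidences meet at most 4, 5 and 4 excluded colors.

Color both ends of the pendent edge `uv` as prescribed. Let `Q` be the set of remaining non-pendent
vertices. The hypothesis on `deletePendent G` makes `Q` connected, so `Q` can be colored inwards
towards any nonempty root set, each vertex still having an uncolored neighbor when its turn comes.
If some vertex of `Q` has a pendent neighbor, it is the root and is itself colored greedily.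
Otherwise every vertex of `Q` has two neighbors in `Q`, and the root is a shortest cycle, which has
no chords. The other pendent vertices come last.

The hard part is closing the cycle (`exists_cycle_coloring`). The forward, backward and outward
incidences of a cycle vertex keep lists of sizes 5, 5 and 3. The greedy step maintains an invariant
that keeps the next vertex colorable, and two colors facing the last vertex are chosen in advance so
that together they cost each of its lists at most one color. -/

namespace IncidenceColoring

/-! ### List-coloring lemmas for the cycle. -/

section Lists

variable {C : Type*} [DecidableEq C]

/-- The sizes leave no slack: `P` lies in `Z`, and `P` and `{b, c}` are disjoint subsets of `Y`, so
`Y` is the disjoint union of `Z` and `{b, c}`. This isolates the only obstruction to the greedy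
step. -/
theorem sdiff_eq_pair {P Y Z : Finset C} {b c : C} (hY : 5 ≤ Y.card) (hZ : 3 ≤ Z.card)
    (h : Y \ (P ∪ {b, c}) = Z \ P) (hcard : (Z \ P).card + P.card ≤ 3) :
    ({b, c} : Finset C) = Y \ Z := by
  have h1 := Finset.card_sdiff_add_card_inter Z P
  have h2 := Finset.card_sdiff_add_card_inter Y (P ∪ {b, c})
  have h3 : (P ∪ {b, c}).card ≤ P.card + ({b, c} : Finset C).card := Finset.card_union_le _ _
  have h4 : ({b, c} : Finset C).card ≤ 2 := Finset.card_le_two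
  have h5 : Z ∩ P = P := Finset.eq_of_subset_of_card_le Finset.inter_subset_right (by omega)
  have h6 : Y ∩ (P ∪ {b, c}) = P ∪ {b, c} :=
    Finset.eq_of_subset_of_card_le Finset.inter_subset_right (by rw [h] at h2; omega)
  have h7 : Disjoint P {b, c} := by
    rw [← Finset.card_union_eq_card_add_card]
    rw [h, h6] at h2
    omega
  have hb : b ∉ P := fun hb => Finset.disjoint_left.1 h7 hb (by simp)
  have hc : c ∉ P := fun hc => Finset.disjoint_left.1 h7 hc (by simp)
  ext w
  have e1 := Finset.ext_iff.1 h w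
  have e5 := Finset.ext_iff.1 h5 w
  have e6 := Finset.ext_iff.1 h6 w
  simp only [Finset.mem_sdiff, Finset.mem_union, Finset.mem_inter, Finset.mem_insert,
    Finset.mem_singleton] at *
  grind

theorem card_sdiff_ge {A F : Finset C} {k l : ℕ} (hA : k + l ≤ A.card) (hF : F.card ≤ l) :
    k ≤ (A \ F).card := by
  have := Finset.le_card_sdiff F A
  omega

/-- Two lists, not both equal to the same small set, have distinct representatives whose pair
avoids a given set. -/
theorem exists_pair_ne {A B E : Finset C} (hA : 2 ≤ A.card) (hB : 2 ≤ B.card)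
    (h : A = B → 3 ≤ A.card) :
    ∃ y ∈ A, ∃ z ∈ B, y ≠ z ∧ ({y, z} : Finset C) ≠ E := by
  by_cases h1 : A ⊆ E
  · by_cases h2 : B ⊆ E
    · obtain ⟨y, hy⟩ : A.Nonempty := Finset.card_pos.1 (by omega)
      obtain ⟨z, hz, hzy⟩ := Finset.exists_mem_notMem_of_card_lt_card
        (s := {y}) (t := B) (by simpa using by omega)
      refine ⟨y, hy, z, hz, by grind, ?_⟩
      rintro rfl
      have h4 : ({y, z} : Finset C).card ≤ 2 := Finset.card_le_two
      have hAE := Finset.eq_of_subset_of_card_le h1 (by omega)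
      have hBE := Finset.eq_of_subset_of_card_le h2 (by omega)
      have := h (hAE.trans hBE.symm)
      rw [hAE] at this
      omega
    · obtain ⟨z, hz, hzE⟩ := Finset.not_subset.1 h2
      obtain ⟨y, hy, hyz⟩ := Finset.exists_mem_notMem_of_card_lt_card
        (s := {z}) (t := A) (by simpa using by omega)
      exact ⟨y, hy, z, hz, by grind, by rintro rfl; simp at hzE⟩
  · obtain ⟨y, hy, hyE⟩ := Finset.not_subset.1 h1
    obtain ⟨z, hz, hzy⟩ := Finset.exists_mem_notMem_of_card_lt_card
      (s := {y}) (t := B) (by simpa using by omega)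
    exact ⟨y, hy, z, hz, by grind, by rintro rfl; simp at hyE⟩

/-- The greedy step along the cycle: `a`, `b`, `c` are the forward, backward and outward colors at
the previous vertex. The new backward and outward colors have at least two candidates each, and
`hne` excludes that both lists are the same pair. The set `E` is the obstruction for the following
step, so the invariant propagates. -/
theorem exists_next {X Y Z : Finset C} (E : Finset C) {a b c : C} (hX : 4 ≤ X.card)
    (hY : 5 ≤ Y.card) (hZ : 3 ≤ Z.card) (hne : ({b, c} : Finset C) ≠ Y \ Z) :
    ∃ x ∈ X, ∃ y ∈ Y, ∃ z ∈ Z, x ≠ y ∧ x ≠ z ∧ y ≠ z ∧ a ≠ x ∧ a ≠ y ∧ a ≠ z ∧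
      y ≠ b ∧ y ≠ c ∧ ({y, z} : Finset C) ≠ E := by
  have hF : ({a} ∪ {b, c} : Finset C).card ≤ 3 := by
    have := Finset.card_union_le {a} ({b, c} : Finset C)
    have := Finset.card_le_two (a := b) (b := c)
    simp at *; omega
  obtain ⟨y, hy, z, hz, hyz, hE⟩ := exists_pair_ne (A := Y \ ({a} ∪ {b, c})) (B := Z \ {a}) (E := E)
    (card_sdiff_ge hY hF) (card_sdiff_ge (l := 1) hZ (by simp)) (by
      intro h
      by_contra hlt
      refine hne (sdiff_eq_pair hY hZ h ?_)
      rw [← h, Finset.card_singleton]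
      omega)
  obtain ⟨x, hx, hxn⟩ := Finset.exists_mem_notMem_of_card_lt_card
    (s := {a, y, z}) (t := X) (Finset.card_le_three.trans_lt hX)
  simp only [Finset.mem_sdiff, Finset.mem_union, Finset.mem_insert, Finset.mem_singleton,
    not_or] at *
  exact ⟨x, hx, y, hy.1, z, hz.1, hxn.2.1, hxn.2.2, hyz, Ne.symm hxn.1, by grind, by grind,
    by grind, by grind, hE⟩

/-- The greedy step when the forward color `d` is already fixed. The two lists may shrink to
singletons, but the obstruction is the same. -/
theorem exists_next_of_fixed {Y Z : Finset C} {a b c d : C}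
    (hY : 5 ≤ Y.card) (hZ : 3 ≤ Z.card) (hne : ({b, c} : Finset C) ≠ Y \ Z) :
    ∃ y ∈ Y, ∃ z ∈ Z, d ≠ y ∧ d ≠ z ∧ y ≠ z ∧ a ≠ y ∧ a ≠ z ∧ y ≠ b ∧ y ≠ c := by
  have hP : ({a, d} : Finset C).card ≤ 2 := Finset.card_le_two
  have hF : ({a, d} ∪ {b, c} : Finset C).card ≤ 4 := by
    have := Finset.card_union_le {a, d} ({b, c} : Finset C)
    have := Finset.card_le_two (a := b) (b := c)
    omega
  have hA : 1 ≤ (Y \ ({a, d} ∪ {b, c})).card := card_sdiff_ge hY hF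
  have hB : 1 ≤ (Z \ {a, d}).card := card_sdiff_ge hZ hP
  obtain ⟨y, hy, z, hz, hyz⟩ : ∃ y ∈ Y \ ({a, d} ∪ {b, c}), ∃ z ∈ Z \ {a, d}, y ≠ z := by
    by_contra! hcon
    obtain ⟨y, hy⟩ := Finset.card_pos.1 hA
    obtain ⟨z, hz⟩ := Finset.card_pos.1 hB
    have e1 : Y \ ({a, d} ∪ {b, c}) = {z} :=
      Finset.eq_singleton_iff_unique_mem.2 ⟨hcon y hy z hz ▸ hy, fun w hw => hcon w hw z hz⟩
    have e2 : Z \ {a, d} = {z} :=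
      Finset.eq_singleton_iff_unique_mem.2
        ⟨hz, fun w hw => (hcon y hy w hw).symm.trans (hcon y hy z hz)⟩
    refine hne (sdiff_eq_pair hY hZ (e1.trans e2.symm) ?_)
    rw [e2]
    simp; omega
  simp only [Finset.mem_sdiff, Finset.mem_union, Finset.mem_insert, Finset.mem_singleton,
    not_or] at *
  exact ⟨y, hy.1, z, hz.1, by grind, by grind, hyz, by grind, by grind, by grind, by grind⟩

/-- Distinct representatives for three lists of size two, the first two of them distinct. -/
theorem exists_triple {P Q R : Finset C} (hP : 2 ≤ P.card) (hQ : 2 ≤ Q.card) (hR : 2 ≤ R.card)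
    (hne : P ≠ Q) : ∃ p ∈ P, ∃ q ∈ Q, ∃ r ∈ R, p ≠ q ∧ p ≠ r ∧ q ≠ r := by
  by_cases h : P ⊆ Q
  · obtain ⟨q, hq, hqP⟩ := Finset.not_subset.1 fun h' => hne (h.antisymm h')
    obtain ⟨r, hr, hrq⟩ := Finset.exists_mem_notMem_of_card_lt_card
      (s := {q}) (t := R) (by simpa using by omega)
    obtain ⟨p, hp, hpr⟩ := Finset.exists_mem_notMem_of_card_lt_card
      (s := {r}) (t := P) (by simpa using by omega)
    exact ⟨p, hp, q, hq, r, hr, by grind, by grind, by grind⟩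
  · obtain ⟨p, hp, hpQ⟩ := Finset.not_subset.1 h
    obtain ⟨r, hr, hrp⟩ := Finset.exists_mem_notMem_of_card_lt_card
      (s := {p}) (t := R) (by simpa using by omega)
    obtain ⟨q, hq, hqr⟩ := Finset.exists_mem_notMem_of_card_lt_card
      (s := {r}) (t := Q) (by simpa using by omega)
    exact ⟨p, hp, q, hq, r, hr, by grind, by grind, by grind⟩

/-- Colors for two non-adjacent elements that together exclude at most one color from each of
three further lists. -/
theorem exists_saving_pair {A B X Y Z : Finset C} (hA : 5 ≤ A.card) (hB : 5 ≤ B.card)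
    (hX : X.card = 5) (hY : Y.card = 5) (hZ : Z.card = 3) :
    ∃ a ∈ A, ∃ b ∈ B, 4 ≤ (X \ {a, b}).card ∧ 4 ≤ (Y \ {a, b}).card ∧ 2 ≤ (Z \ {a, b}).card := by
  suffices h : ∃ a ∈ A, ∃ b ∈ B, (a = b ∨ ((a ∉ X ∨ b ∉ X) ∧ (a ∉ Y ∨ b ∉ Y) ∧ (a ∉ Z ∨ b ∉ Z))) by
    obtain ⟨a, ha, b, hb, h⟩ := h
    have key : ∀ M : Finset C, (a = b ∨ a ∉ M ∨ b ∉ M) → M.card - 1 ≤ (M \ {a, b}).card := by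
      rintro M (rfl | h | h)
      · have := Finset.le_card_sdiff {a} M
        simpa using this
      · have : M \ {a, b} = M \ {b} := by grind
        rw [this]
        have := Finset.le_card_sdiff {b} M
        simpa using this
      · have : M \ {a, b} = M \ {a} := by grind
        rw [this]
        have := Finset.le_card_sdiff {a} M
        simpa using this
    have h1 := key X (by tauto)
    have h2 := key Y (by tauto)
    have h3 := key Z (by tauto)
    exact ⟨a, ha, b, hb, by omega, by omega, by omega⟩
  by_contra! hcon
  -- Otherwise each of the at least 25 pairs lies inside `X`, `Y` or `Z`. Since `A` and `B` are
  -- disjoint, these sets contain at most 6, 6 and 2 pairs.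
  have hdisj : Disjoint A B := Finset.disjoint_left.2 fun a ha hb => (hcon a ha a hb).1 rfl
  have hsub : A ×ˢ B ⊆ ((A ∩ X) ×ˢ (B ∩ X) ∪ (A ∩ Y) ×ˢ (B ∩ Y)) ∪ (A ∩ Z) ×ˢ (B ∩ Z) := by
    rintro ⟨a, b⟩ h
    have := hcon a (by grind) b (by grind)
    simp only [Finset.mem_union, Finset.mem_product, Finset.mem_inter] at *
    tauto
  have hsum : ∀ M : Finset C, (A ∩ M).card + (B ∩ M).card ≤ M.card := by
    intro M
    rw [← Finset.card_union_of_disjoint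
      (hdisj.mono Finset.inter_subset_left Finset.inter_subset_left)]
    exact Finset.card_le_card (by grind)
  have hc := Finset.card_le_card hsub
  have h1 := Finset.card_union_le ((A ∩ X) ×ˢ (B ∩ X) ∪ (A ∩ Y) ×ˢ (B ∩ Y)) ((A ∩ Z) ×ˢ (B ∩ Z))
  have h2 := Finset.card_union_le ((A ∩ X) ×ˢ (B ∩ X)) ((A ∩ Y) ×ˢ (B ∩ Y))
  simp only [Finset.card_product] at *
  have hx := hsum X
  have hy := hsum Y
  have hz := hsum Z
  have five : ∀ p q : ℕ, p + q ≤ 5 → p * q ≤ 6 := by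
    intro p q h
    have : p ≤ 5 := by omega
    interval_cases p <;> omega
  have three : ∀ p q : ℕ, p + q ≤ 3 → p * q ≤ 2 := by
    intro p q h
    have : p ≤ 3 := by omega
    interval_cases p <;> omega
  have := five _ _ (hX ▸ hx)
  have := five _ _ (hY ▸ hy)
  have := three _ _ (hZ ▸ hz)
  have : 5 * 5 ≤ A.card * B.card := Nat.mul_le_mul hA hB
  omega

/-- Colors `x i`, `y i`, `z i` along a path of length `k`, starting from given colors at `0`. -/
theorem exists_path_coloring {X Y Z : ℕ → Finset C} {d x₀ y₀ z₀ : C} (k : ℕ)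
    (hX : ∀ i ≤ k, 5 ≤ (X i).card) (hY : ∀ i ≤ k + 1, 5 ≤ (Y i).card)
    (hZ : ∀ i ≤ k + 1, 3 ≤ (Z i).card)
    (h0 : x₀ ∈ X 0 ∧ y₀ ∈ Y 0 ∧ z₀ ∈ Z 0 ∧ x₀ ≠ y₀ ∧ x₀ ≠ z₀ ∧ y₀ ≠ z₀ ∧ x₀ ≠ d)
    (h1 : ({y₀, z₀} : Finset C) ≠ Y 1 \ Z 1) :
    ∃ x y z : ℕ → C, x 0 = x₀ ∧ y 0 = y₀ ∧ z 0 = z₀ ∧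
      (∀ i ≤ k, x i ∈ X i ∧ y i ∈ Y i ∧ z i ∈ Z i ∧ x i ≠ y i ∧ x i ≠ z i ∧ y i ≠ z i ∧ x i ≠ d) ∧
      (∀ i < k, x i ≠ x (i + 1) ∧ x i ≠ y (i + 1) ∧ x i ≠ z (i + 1) ∧
        y (i + 1) ≠ y i ∧ y (i + 1) ≠ z i) ∧
      ({y k, z k} : Finset C) ≠ Y (k + 1) \ Z (k + 1) := by
  induction k with
  | zero =>
    refine ⟨fun _ => x₀, fun _ => y₀, fun _ => z₀, rfl, rfl, rfl, ?_, by simp, by simpa using h1⟩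
    intro i hi
    obtain rfl : i = 0 := by omega
    exact h0
  | succ k ih =>
    obtain ⟨x, y, z, ex, ey, ez, hin, hcon, hlast⟩ := ih (fun i hi => hX i (by omega))
      (fun i hi => hY i (by omega)) (fun i hi => hZ i (by omega))
    -- Erasing the reserved color `d` leaves the four forward colors that `exists_next` requires.
    obtain ⟨a, ha, b, hb, c, hc, hab, hac, hbc, h1, h2, h3, h4, h5, h6⟩ :=
      exists_next (X := (X (k + 1)).erase d) (Y := Y (k + 1)) (Z := Z (k + 1)) (a := x k)
        (Y (k + 2) \ Z (k + 2))
        (by have := hX (k + 1) le_rfl; have := Finset.pred_card_le_card_erase (s := X (k + 1)) (a := d); omega)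
        (hY _ (by omega)) (hZ _ (by omega)) hlast
    rw [Finset.mem_erase] at ha
    refine ⟨Function.update x (k + 1) a, Function.update y (k + 1) b, Function.update z (k + 1) c,
      by simpa using ex, by simpa using ey, by simpa using ez, ?_, ?_, by simpa using h6⟩
    · intro i hi
      rcases Nat.lt_or_ge k i with h | h
      · obtain rfl : i = k + 1 := by omega
        simp only [Function.update_self]
        exact ⟨ha.2, hb, hc, hab, hac, hbc, ha.1⟩
      · have : i ≠ k + 1 := by omega
        simpa only [Function.update_of_ne this] using hin i h
    · intro i hi
      have hne : i ≠ k + 1 := by omega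
      rcases Nat.lt_or_ge i k with h | h
      · have : i + 1 ≠ k + 1 := by omega
        simpa only [Function.update_of_ne hne, Function.update_of_ne this] using hcon i h
      · obtain rfl : i = k := by omega
        simp only [Function.update_of_ne hne, Function.update_self]
        exact ⟨h1, h2, h3, h4, h5⟩

/-- The cycle lemma, with the cycle given as the path `0, …, k + 2` and the edge joining its
ends. -/
theorem exists_closed_path_coloring {X Y Z : ℕ → Finset C} (k : ℕ)
    (hX : ∀ i, 5 ≤ (X i).card) (hY : ∀ i, 5 ≤ (Y i).card) (hZ : ∀ i, 3 ≤ (Z i).card) :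
    ∃ x y z : ℕ → C,
      (∀ i ≤ k + 2, x i ∈ X i ∧ y i ∈ Y i ∧ z i ∈ Z i ∧ x i ≠ y i ∧ x i ≠ z i ∧ y i ≠ z i) ∧
      (∀ i < k + 2, x i ≠ x (i + 1) ∧ x i ≠ y (i + 1) ∧ x i ≠ z (i + 1) ∧
        y (i + 1) ≠ y i ∧ y (i + 1) ≠ z i) ∧
      (x (k + 2) ≠ x 0 ∧ x (k + 2) ≠ y 0 ∧ x (k + 2) ≠ z 0 ∧
        y 0 ≠ y (k + 2) ∧ y 0 ≠ z (k + 2)) := by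
  -- All three colors at the last vertex must avoid both the forward color `d` at `k + 1` and the
  -- backward color `y₀` at `0`. These two do not conflict with each other, so they can be chosen
  -- first. Exact list sizes are needed for the counting.
  obtain ⟨X', hX's, hX'⟩ := Finset.exists_subset_card_eq (hX (k + 2))
  obtain ⟨Y', hY's, hY'⟩ := Finset.exists_subset_card_eq (hY (k + 2))
  obtain ⟨Z', hZ's, hZ'⟩ := Finset.exists_subset_card_eq (hZ (k + 2))
  obtain ⟨d, hd, y₀, hy₀, cX, cY, cZ⟩ :=
    exists_saving_pair (hX (k + 1)) (hY 0) hX' hY' hZ'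
  obtain ⟨X₁, hX₁s, hX₁⟩ := Finset.exists_subset_card_eq cX
  obtain ⟨Z₁, hZ₁s, hZ₁⟩ := Finset.exists_subset_card_eq cZ
  -- There are two candidates for `z₀`, and at most one of them completes the forbidden pair. The
  -- choice of `x₀` below works the same way.
  obtain ⟨z₀, hz₀, hz₀y, hE⟩ : ∃ z₀ ∈ Z 0, y₀ ≠ z₀ ∧ ({y₀, z₀} : Finset C) ≠ Y 1 \ Z 1 := by
    obtain ⟨z, hz, hzn⟩ := Finset.exists_mem_notMem_of_card_lt_card
      (s := {y₀}) (t := Z 0) (by have := hZ 0; simp; omega)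
    obtain ⟨z', hz', hzn'⟩ := Finset.exists_mem_notMem_of_card_lt_card
      (s := {y₀, z}) (t := Z 0) (Finset.card_le_two.trans_lt (hZ 0))
    by_cases h : ({y₀, z} : Finset C) = Y 1 \ Z 1
    · refine ⟨z', hz', by grind, fun h' => ?_⟩
      have := Finset.ext_iff.1 (h'.trans h.symm) z'
      grind
    · exact ⟨z, hz, by grind, h⟩
  obtain ⟨x₀, hx₀, hx₀y, hx₀z, hx₀d, hF⟩ : ∃ x₀ ∈ X 0, x₀ ≠ y₀ ∧ x₀ ≠ z₀ ∧ x₀ ≠ d ∧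
      ({x₀, z₀} : Finset C) ≠ X₁ \ Z₁ := by
    obtain ⟨x, hx, hxn⟩ := Finset.exists_mem_notMem_of_card_lt_card
      (s := {y₀, z₀, d}) (t := X 0) (Finset.card_le_three.trans_lt (by have := hX 0; omega))
    obtain ⟨x', hx', hxn'⟩ := Finset.exists_mem_notMem_of_card_lt_card
      (s := {y₀, z₀, d, x}) (t := X 0) (Finset.card_le_four.trans_lt (hX 0))
    by_cases h : ({x, z₀} : Finset C) = X₁ \ Z₁
    · refine ⟨x', hx', by grind, by grind, by grind, fun h' => ?_⟩
      have := Finset.ext_iff.1 (h'.trans h.symm) x'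
      grind
    · exact ⟨x, hx, by grind, by grind, by grind, h⟩
  obtain ⟨x, y, z, ex, ey, ez, hin, hcon, hlast⟩ := exists_path_coloring (X := X) (Y := Y) (Z := Z)
    (d := d) k (fun i _ => hX i) (fun i _ => hY i) (fun i _ => hZ i)
    ⟨hx₀, hy₀, hz₀, hx₀y, hx₀z, hz₀y, hx₀d⟩ hE
  obtain ⟨b, hb, c, hc, hdb, hdc, hbc, h1, h2, h3, h4⟩ :=
    exists_next_of_fixed (a := x k) (d := d) (hY (k + 1)) (hZ (k + 1)) hlast
  -- Three lists of size two at the last vertex fail only if they all coincide. The choice of `x₀`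
  -- separates the forward list from the outward one.
  have hPne : X₁ \ {x₀, z₀} ≠ Z₁ := by
    intro h
    have hsub : Z₁ ⊆ X₁ := h ▸ Finset.sdiff_subset
    have hc1 := Finset.card_sdiff_add_card_eq_card hsub
    refine hF (Finset.eq_of_subset_of_card_le ?_ ?_).symm
    · rw [← h]; grind
    · exact Finset.card_le_two.trans (by omega)
  obtain ⟨p, hp, r, hr, q, hq, hpr, hpq, hrq⟩ := exists_triple
    (P := X₁ \ {x₀, z₀}) (Q := Z₁) (R := (Y' \ {d, y₀}) \ {b, c})
    (card_sdiff_ge (by omega) Finset.card_le_two) hZ₁.ge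
    (card_sdiff_ge (by omega) Finset.card_le_two) hPne
  have hpX : p ∈ X (k + 2) ∧ p ≠ d ∧ p ≠ y₀ := by
    have := hX₁s (Finset.mem_sdiff.1 hp).1
    simp only [Finset.mem_sdiff, Finset.mem_insert, Finset.mem_singleton, not_or] at this
    exact ⟨hX's this.1, this.2⟩
  have hrZ : r ∈ Z (k + 2) ∧ r ≠ d ∧ r ≠ y₀ := by
    have := hZ₁s hr
    simp only [Finset.mem_sdiff, Finset.mem_insert, Finset.mem_singleton, not_or] at this
    exact ⟨hZ's this.1, this.2⟩
  have hqY : q ∈ Y' → q ∈ Y (k + 2) := fun h => hY's h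
  simp only [Finset.mem_sdiff, Finset.mem_insert, Finset.mem_singleton, not_or] at hp hq
  let append (u : ℕ → C) (v w : C) : ℕ → C :=
    Function.update (Function.update u (k + 1) v) (k + 2) w
  have e1 : ∀ u v w, ∀ i ≤ k, append u v w i = u i := by
    intro u v w i hi
    simp [append, Function.update_of_ne (show i ≠ k + 1 by omega),
      Function.update_of_ne (show i ≠ k + 2 by omega)]
  have e2 : ∀ u v w, append u v w (k + 1) = v := by intro u v w; simp [append]
  have e3 : ∀ u v w, append u v w (k + 2) = w := by intro u v w; simp [append]
  refine ⟨append x d p, append y b q, append z c r, ?_, ?_, ?_⟩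
  · intro i hi
    rcases Nat.lt_or_ge k i with h | h
    · obtain rfl | rfl : i = k + 1 ∨ i = k + 2 := by omega
      · simp only [e2]
        exact ⟨hd, hb, hc, hdb, hdc, hbc⟩
      · simp only [e3]
        exact ⟨hpX.1, hqY hq.1.1, hrZ.1, hpq, hpr, hrq.symm⟩
    · simp only [e1 _ _ _ i h]
      obtain ⟨g1, g2, g3, g4, g5, g6, -⟩ := hin i h
      exact ⟨g1, g2, g3, g4, g5, g6⟩
  · intro i hi
    rcases Nat.lt_trichotomy i k with h | rfl | h
    · simp only [e1 _ _ _ i h.le, e1 _ _ _ (i + 1) h]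
      exact hcon i h
    · simp only [e1 _ _ _ i le_rfl, e2]
      exact ⟨(hin i le_rfl).2.2.2.2.2.2, h1, h2, h3, h4⟩
    · obtain rfl : i = k + 1 := by omega
      simp only [e2, e3]
      exact ⟨hpX.2.1.symm, fun h => hq.1.2.1 h.symm, hrZ.2.1.symm, hq.2.1, hq.2.2⟩
  · simp only [e3, e1 _ _ _ 0 (Nat.zero_le k), ex, ey, ez]
    exact ⟨hp.2.1, hpX.2.2, hp.2.2, fun h => hq.1.2.2 h.symm, hrZ.2.2.symm⟩

theorem exists_cycle_coloring {k : ℕ} {X Y Z : Fin (k + 3) → Finset C}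
    (hX : ∀ i, 5 ≤ (X i).card) (hY : ∀ i, 5 ≤ (Y i).card) (hZ : ∀ i, 3 ≤ (Z i).card) :
    ∃ x y z : Fin (k + 3) → C,
      (∀ i, x i ∈ X i ∧ y i ∈ Y i ∧ z i ∈ Z i ∧ x i ≠ y i ∧ x i ≠ z i ∧ y i ≠ z i) ∧
      (∀ i, x i ≠ x (i + 1) ∧ x i ≠ y (i + 1) ∧ x i ≠ z (i + 1) ∧
        y (i + 1) ≠ y i ∧ y (i + 1) ≠ z i) := by
  obtain ⟨x, y, z, hin, hcon, hlast⟩ := exists_closed_path_coloring (X := fun i => X (Fin.ofNat _ i))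
    (Y := fun i => Y (Fin.ofNat _ i)) (Z := fun i => Z (Fin.ofNat _ i)) k
    (fun i => hX _) (fun i => hY _) (fun i => hZ _)
  refine ⟨fun i => x i, fun i => y i, fun i => z i, fun i => ?_, fun i => ?_⟩
  · simpa using hin i (by omega)
  · rcases eq_or_ne i (Fin.last (k + 2)) with rfl | h
    · simpa using hlast
    · have : ((i + 1 : Fin (k + 3)) : ℕ) = i + 1 := Fin.val_add_one_of_lt (Fin.lt_last_iff_ne_last.2 h)
      simp only [this]
      exact hcon i (Fin.lt_last_iff_ne_last.2 h)

end Lists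

end IncidenceColoring

namespace IncidenceColoring

/-! ### Extending a partial coloring by a vertex or by an induced cycle. -/

section Extension

variable {V : Type*} {C : Type*}

/-- `φ` colors the incidences `(u, uv)` with `u ∈ D` from the lists `ℓ u v`, properly. -/
structure GoodOn (G : SimpleGraph V) (ℓ : V → V → Finset C) (D : Finset V) (φ : V → V → C) :
    Prop where
  mem : ∀ u ∈ D, ∀ v, G.Adj u v → φ u v ∈ ℓ u v
  inj : ∀ u ∈ D, ∀ v w, G.Adj u v → G.Adj u w → v ≠ w → φ u v ≠ φ u w
  inout : ∀ u ∈ D, ∀ v ∈ D, G.Adj u v → ∀ w, G.Adj v w → φ u v ≠ φ v w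

/-- The colors used by `φ` on the incidences at `v`. -/
def outColors [DecidableEq C] (G : SimpleGraph V) [G.LocallyFinite] (φ : V → V → C) (v : V) : Finset C :=
  (G.neighborFinset v).image (φ v)

theorem mem_outColors [DecidableEq C] {G : SimpleGraph V} [G.LocallyFinite] {φ : V → V → C}
    {v w : V} (h : G.Adj v w) : φ v w ∈ outColors G φ v :=
  Finset.mem_image_of_mem _ ((G.mem_neighborFinset v w).2 h)

theorem card_outColors_le [DecidableEq C] {G : SimpleGraph V} [G.LocallyFinite] {φ : V → V → C}
    (hdeg : ∀ v, G.degree v ≤ 3) (v : V) :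
    (outColors G φ v).card ≤ 3 :=
  Finset.card_image_le.trans (hdeg v)

variable [DecidableEq V] {G : SimpleGraph V} {ℓ : V → V → Finset C} {D S : Finset V}
  {φ ψ : V → V → C}

theorem GoodOn.union (h : GoodOn G ℓ D φ) (hS : GoodOn G ℓ S ψ) (heq : ∀ u ∈ D, ψ u = φ u)
    (h1 : ∀ u ∈ D, ∀ v ∈ S, G.Adj u v → ∀ w, G.Adj v w → φ u v ≠ ψ v w)
    (h2 : ∀ u ∈ S, ∀ v ∈ D, G.Adj u v → ∀ w, G.Adj v w → ψ u v ≠ φ v w) :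
    GoodOn G ℓ (D ∪ S) ψ where
  mem u hu := by
    rcases Finset.mem_union.1 hu with hu | hu
    · rw [heq u hu]; exact h.mem u hu
    · exact hS.mem u hu
  inj u hu := by
    rcases Finset.mem_union.1 hu with hu | hu
    · rw [heq u hu]; exact h.inj u hu
    · exact hS.inj u hu
  inout u hu v hv := by
    rcases Finset.mem_union.1 hu with hu | hu <;> rcases Finset.mem_union.1 hv with hv | hv
    · rw [heq u hu, heq v hv]; exact h.inout u hu v hv
    · rw [heq u hu]; exact h1 u hu v hv
    · rw [heq v hv]; exact h2 u hu v hv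
    · exact hS.inout u hu v hv

theorem GoodOn.insert {x : V} {g : V → C} (h : GoodOn G ℓ D φ) (hx : x ∉ D)
    (hmem : ∀ v, G.Adj x v → g v ∈ ℓ x v)
    (hinj : ∀ v w, G.Adj x v → G.Adj x w → v ≠ w → g v ≠ g w)
    (hin : ∀ v ∈ D, G.Adj x v → ∀ w, G.Adj x w → φ v x ≠ g w)
    (hout : ∀ v ∈ D, G.Adj x v → ∀ w, G.Adj v w → g v ≠ φ v w) :
    GoodOn G ℓ (insert x D) (Function.update φ x g) := by
  rw [Finset.insert_eq, Finset.union_comm]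
  refine h.union ⟨?_, ?_, ?_⟩ ?_ ?_ ?_
  · intro u hu
    obtain rfl := Finset.mem_singleton.1 hu
    simpa using hmem
  · intro u hu
    obtain rfl := Finset.mem_singleton.1 hu
    simpa using hinj
  · intro u hu v hv huv
    obtain rfl := Finset.mem_singleton.1 hu
    obtain rfl := Finset.mem_singleton.1 hv
    exact (G.loopless.irrefl _ huv).elim
  · intro u hu
    exact Function.update_of_ne (ne_of_mem_of_not_mem hu hx) _ _
  · intro u hu v hv huv
    obtain rfl := Finset.mem_singleton.1 hv
    simpa using hin u hu huv.symm
  · intro u hu v hv huv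
    obtain rfl := Finset.mem_singleton.1 hu
    simpa using hout v hv huv

variable [DecidableEq C] [G.LocallyFinite]

theorem GoodOn.exists_insert_of_degree_eq_one (hdeg : ∀ v, G.degree v ≤ 3)
    (hℓ : ∀ u v, G.Adj u v → 6 ≤ (ℓ u v).card) (h : GoodOn G ℓ D φ) {x : V} (hx : x ∉ D)
    (hx1 : G.degree x = 1) : ∃ ψ, GoodOn G ℓ (Insert.insert x D) ψ ∧ ∀ u ∈ D, ψ u = φ u := by
  obtain ⟨w, hw⟩ := Finset.card_eq_one.1 (hx1 : (G.neighborFinset x).card = 1)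
  have hadj : ∀ v, G.Adj x v ↔ v = w := fun v => by
    rw [← G.mem_neighborFinset, hw, Finset.mem_singleton]
  have hxw : G.Adj x w := (hadj w).2 rfl
  obtain ⟨c, hc, hcn⟩ := Finset.exists_mem_notMem_of_card_lt_card
    (s := outColors G φ w) (t := ℓ x w)
    (by have := card_outColors_le (φ := φ) hdeg w; have := hℓ x w hxw; omega)
  refine ⟨_, h.insert (g := fun _ => c) hx ?_ ?_ ?_ ?_,
    fun u hu => Function.update_of_ne (ne_of_mem_of_not_mem hu hx) _ _⟩
  · intro v hv
    obtain rfl := (hadj v).1 hv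
    exact hc
  · intro v v' hv hv' hne
    exact (hne (((hadj v).1 hv).trans ((hadj v').1 hv').symm)).elim
  · rintro v - hv - - rfl
    obtain rfl := (hadj v).1 hv
    exact hcn (mem_outColors hxw.symm)
  · rintro v - hv w' hvw rfl
    obtain rfl := (hadj v).1 hv
    exact hcn (mem_outColors hvw)

theorem exists_neighbors_of_degree_eq_three {x w : V} (hx : G.degree x = 3) (hw : G.Adj x w) :
    ∃ a b, a ≠ b ∧ a ≠ w ∧ b ≠ w ∧ ∀ v, G.Adj x v ↔ v = a ∨ v = b ∨ v = w := by
  have h2 : ((G.neighborFinset x).erase w).card = 2 := by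
    rw [Finset.card_erase_of_mem ((G.mem_neighborFinset x w).2 hw)]
    change G.degree x - 1 = 2
    omega
  obtain ⟨a, b, hab, he⟩ := Finset.card_eq_two.1 h2
  have key := Finset.ext_iff.1 he
  simp only [Finset.mem_erase, SimpleGraph.mem_neighborFinset, Finset.mem_insert,
    Finset.mem_singleton] at key
  refine ⟨a, b, hab, ((key a).2 (Or.inl rfl)).1, ((key b).2 (Or.inr rfl)).1, fun v => ?_⟩
  have := key v
  by_cases hv : v = w
  · subst hv; simp [hw]
  · tauto

theorem GoodOn.exists_insert_of_degree_eq_three (hdeg : ∀ v, G.degree v ≤ 3)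
    (hℓ : ∀ u v, G.Adj u v → 6 ≤ (ℓ u v).card) (h : GoodOn G ℓ D φ) {x w : V} (hx : x ∉ D)
    (hx3 : G.degree x = 3) (hxw : G.Adj x w) (hw : w ∉ D) :
    ∃ ψ, GoodOn G ℓ (Insert.insert x D) ψ ∧ ∀ u ∈ D, ψ u = φ u := by
  obtain ⟨a, b, hab, haw, hbw, hadj⟩ := exists_neighbors_of_degree_eq_three hx3 hxw
  have hxa : G.Adj x a := (hadj a).2 (by simp)
  have hxb : G.Adj x b := (hadj b).2 (by simp)
  have hca := card_outColors_le (φ := φ) hdeg a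
  have hcb := card_outColors_le (φ := φ) hdeg b
  have hla := hℓ x a hxa
  have hlb := hℓ x b hxb
  have hlw := hℓ x w hxw
  -- The values of `φ` at `a` and `b` are avoided even if these vertices are uncolored; this is
  -- harmless, and the bounds 4, 5 and 4 still hold.
  obtain ⟨c, hc, hcn⟩ := Finset.exists_mem_notMem_of_card_lt_card
    (s := outColors G φ a ∪ {φ b x}) (t := ℓ x a) (by
      have := Finset.card_union_le (outColors G φ a) {φ b x}
      rw [Finset.card_singleton] at this
      omega)
  obtain ⟨d, hd, hdn⟩ := Finset.exists_mem_notMem_of_card_lt_card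
    (s := outColors G φ b ∪ {φ a x, c}) (t := ℓ x b) (by
      have := Finset.card_union_le (outColors G φ b) {φ a x, c}
      have := Finset.card_le_two (a := φ a x) (b := c)
      omega)
  obtain ⟨e, he, hen⟩ := Finset.exists_mem_notMem_of_card_lt_card
    (s := {φ a x, φ b x, c, d}) (t := ℓ x w) (by
      have := Finset.card_le_four (a := φ a x) (b := φ b x) (c := c) (d := d)
      omega)
  simp only [Finset.mem_union, Finset.mem_insert, Finset.mem_singleton, not_or] at hcn hdn hen
  have hax := mem_outColors (φ := φ) hxa.symm
  have hbx := mem_outColors (φ := φ) hxb.symm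
  let g : V → C := fun v => if v = a then c else if v = b then d else e
  have ga : g a = c := by simp [g]
  have gb : g b = d := by simp [g, hab.symm]
  have gw : g w = e := by simp [g, haw.symm, hbw.symm]
  refine ⟨_, h.insert (g := g) hx ?_ ?_ ?_ ?_,
    fun u hu => Function.update_of_ne (ne_of_mem_of_not_mem hu hx) _ _⟩
  · intro v hv
    obtain rfl | rfl | rfl := (hadj v).1 hv
    · rwa [ga]
    · rwa [gb]
    · rwa [gw]
  · intro v v' hv hv' hne
    obtain rfl | rfl | rfl := (hadj v).1 hv <;> obtain rfl | rfl | rfl := (hadj v').1 hv' <;>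
      grind
  · intro v hvD hv v' hv'
    obtain rfl | rfl | rfl := (hadj v).1 hv
    · obtain rfl | rfl | rfl := (hadj v').1 hv' <;> grind
    · obtain rfl | rfl | rfl := (hadj v').1 hv' <;> grind
    · exact (hw hvD).elim
  · rintro v hvD hv v' hv'
    have := mem_outColors (φ := φ) hv'
    obtain rfl | rfl | rfl := (hadj v).1 hv
    · grind
    · grind
    · exact (hw hvD).elim

/-- As the cycle is induced, each of its vertices has exactly one neighbor `o i` off the cycle. The
color entering from `o i` costs one color in each cycle direction, and the colors leaving `o i` cost
three in the outward direction, leaving lists of sizes 5, 5 and 3. -/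
theorem GoodOn.exists_union_cycle (hdeg : ∀ v, G.degree v ≤ 3)
    (hℓ : ∀ u v, G.Adj u v → 6 ≤ (ℓ u v).card) (h : GoodOn G ℓ D φ) {k : ℕ}
    {f : Fin (k + 3) → V} (hf : Function.Injective f) (hfD : ∀ i, f i ∉ D)
    (hf3 : ∀ i, G.degree (f i) = 3) (hadj : ∀ i, G.Adj (f i) (f (i + 1)))
    (hind : ∀ i j, G.Adj (f i) (f j) → j = i + 1 ∨ i = j + 1) :
    ∃ ψ, GoodOn G ℓ (D ∪ Finset.univ.image f) ψ ∧ ∀ u ∈ D, ψ u = φ u := by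
  have hadj' : ∀ i, G.Adj (f i) (f (i - 1)) := fun i => by
    simpa using (hadj (i - 1)).symm
  have hne : ∀ i : Fin (k + 3), i + 1 ≠ i - 1 := by
    intro i hi
    have h2 : (1 : Fin (k + 3)) + 1 = 0 := by
      have : i + 1 + 1 = i := by rw [hi]; simp
      rwa [add_assoc, add_eq_left] at this
    have h3 := congrArg Fin.val h2
    rw [Fin.val_add, Fin.val_one, Nat.mod_eq_of_lt (by omega)] at h3
    simp at h3
  have hnb : ∀ i, ∃ o, (∀ j, o ≠ f j) ∧
      ∀ v, G.Adj (f i) v ↔ v = f (i + 1) ∨ v = f (i - 1) ∨ v = o := by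
    intro i
    obtain ⟨a, b, hab, ha, hb, hnbr⟩ := exists_neighbors_of_degree_eq_three (hf3 i) (hadj i)
    have hout : ∀ o, G.Adj (f i) o → o ≠ f (i + 1) → o ≠ f (i - 1) → ∀ j, o ≠ f j := by
      rintro _ ho h1 h2 j rfl
      rcases hind i j ho with rfl | rfl
      · exact h1 rfl
      · simp at h2
    have hne' : f (i - 1) ≠ f (i + 1) := fun h => hne i (hf h).symm
    rcases (hnbr _).1 (hadj' i) with h | h | h
    · exact ⟨b, hout b ((hnbr b).2 (by simp)) hb (by rw [h]; exact hab.symm), by grind⟩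
    · exact ⟨a, hout a ((hnbr a).2 (by simp)) ha (by rw [h]; exact hab), by grind⟩
    · exact (hne' h).elim
  choose o ho hnbr using hnb
  have hio : ∀ i, G.Adj (f i) (o i) := fun i => (hnbr i _).2 (by simp)
  obtain ⟨x, y, z, hin, hcon⟩ := exists_cycle_coloring
    (X := fun i => ℓ (f i) (f (i + 1)) \ {φ (o i) (f i)})
    (Y := fun i => ℓ (f i) (f (i - 1)) \ {φ (o i) (f i)})
    (Z := fun i => ℓ (f i) (o i) \ outColors G φ (o i))
    (fun i => card_sdiff_ge (l := 1) (hℓ _ _ (hadj i)) (by simp))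
    (fun i => card_sdiff_ge (l := 1) (hℓ _ _ (hadj' i)) (by simp))
    (fun i => card_sdiff_ge (l := 3) (hℓ _ _ (hio i)) (card_outColors_le hdeg _))
  let g : Fin (k + 3) → V → C := fun i w =>
    if w = f (i + 1) then x i else if w = f (i - 1) then y i else z i
  have gx : ∀ i, g i (f (i + 1)) = x i := fun i => by simp [g]
  have gy : ∀ i, g i (f (i - 1)) = y i := fun i => by
    simp [g, hf.eq_iff, (hne i).symm]
  have gz : ∀ i, g i (o i) = z i := fun i => by simp [g, ho i]
  have hψ : ∀ i, Function.extend f g φ (f i) = g i := fun i => hf.extend_apply g φ i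
  have hψD : ∀ u ∈ D, Function.extend f g φ u = φ u := fun u hu =>
    Function.extend_apply' _ _ _ (by rintro ⟨i, rfl⟩; exact hfD i hu)
  have hox := fun i => mem_outColors (φ := φ) (hio i).symm
  simp only [Finset.mem_sdiff, Finset.mem_singleton] at hin
  refine ⟨Function.extend f g φ, h.union ⟨?_, ?_, ?_⟩ hψD ?_ ?_, hψD⟩
  · intro u hu v huv
    obtain ⟨i, -, rfl⟩ := Finset.mem_image.1 hu
    obtain ⟨h1, h2, h3, -⟩ := hin i
    rw [hψ]
    obtain rfl | rfl | rfl := (hnbr i v).1 huv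
    · rw [gx]; exact h1.1
    · rw [gy]; exact h2.1
    · rw [gz]; exact h3.1
  · intro u hu v w huv huw hvw
    obtain ⟨i, -, rfl⟩ := Finset.mem_image.1 hu
    obtain ⟨-, -, -, h1, h2, h3⟩ := hin i
    rw [hψ]
    obtain rfl | rfl | rfl := (hnbr i v).1 huv <;> obtain rfl | rfl | rfl := (hnbr i w).1 huw <;>
      simp only [gx, gy, gz] <;> first | exact (hvw rfl).elim | grind
  · intro u hu v hv huv w hvw
    obtain ⟨i, -, rfl⟩ := Finset.mem_image.1 hu
    obtain ⟨j, -, rfl⟩ := Finset.mem_image.1 hv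
    rw [hψ, hψ]
    rcases hind i j huv with rfl | rfl
    · have := hcon i
      obtain rfl | rfl | rfl := (hnbr _ w).1 hvw <;> simp only [gx, gy, gz] <;> tauto
    · have := hcon j
      have e : g (j + 1) (f j) = y (j + 1) := by simpa using gy (j + 1)
      rw [e]
      obtain rfl | rfl | rfl := (hnbr _ w).1 hvw <;> simp only [gx, gy, gz] <;> grind
  · intro u hu v hv huv w hvw
    obtain ⟨i, -, rfl⟩ := Finset.mem_image.1 hv
    obtain ⟨h1, h2, h3, -⟩ := hin i
    have := hox i
    rw [hψ]
    obtain rfl | rfl | rfl := (hnbr i u).1 huv.symm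
    · exact (hfD _ hu).elim
    · exact (hfD _ hu).elim
    · obtain rfl | rfl | rfl := (hnbr i w).1 hvw <;> simp only [gx, gy, gz] <;> grind
  · intro u hu v hv huv w hvw
    obtain ⟨i, -, rfl⟩ := Finset.mem_image.1 hu
    obtain ⟨h1, h2, h3, -⟩ := hin i
    rw [hψ]
    obtain rfl | rfl | rfl := (hnbr i v).1 huv
    · exact (hfD _ hv).elim
    · exact (hfD _ hv).elim
    · have := mem_outColors (φ := φ) hvw
      rw [gz]
      grind

end Extension

end IncidenceColoring

namespace IncidenceColoring

/-! ### Existence of an induced cycle. -/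

section InducedCycle

variable {V : Type*} {G : SimpleGraph V}

/-- The vertices `f 0, …, f (n - 1)` form, in this order, a cycle of `G` inside `Q`. -/
structure IsCycleIn (G : SimpleGraph V) (Q : Finset V) (n : ℕ) (f : ℕ → V) : Prop where
  three_le : 3 ≤ n
  mem : ∀ i < n, f i ∈ Q
  inj : ∀ i < n, ∀ j < n, f i = f j → i = j
  adj : ∀ i, i + 1 < n → G.Adj (f i) (f (i + 1))
  closed : G.Adj (f (n - 1)) (f 0)

theorem exists_isCycleIn {Q : Finset V} (hQ : Q.Nonempty)
    (hdeg : ∀ x ∈ Q, ∀ a, ∃ b ∈ Q, G.Adj x b ∧ b ≠ a) : ∃ n f, IsCycleIn G Q n f := by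
  obtain ⟨q, hq⟩ := hQ
  have hnext : ∀ x a, ∃ b, x ∈ Q → b ∈ Q ∧ G.Adj x b ∧ b ≠ a := fun x a => by
    by_cases hx : x ∈ Q
    · obtain ⟨b, h⟩ := hdeg x hx a
      exact ⟨b, fun _ => h⟩
    · exact ⟨x, fun h => (hx h).elim⟩
  choose next hnext using hnext
  let s : ℕ → V × V := fun i => Nat.rec (q, q) (fun _ p => (p.2, next p.2 p.1)) i
  have hs : ∀ i, s (i + 1) = ((s i).2, next (s i).2 (s i).1) := fun i => rfl
  have hsQ : ∀ i, (s i).2 ∈ Q := by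
    intro i
    induction i with
    | zero => exact hq
    | succ i ih => rw [hs]; exact (hnext _ _ ih).1
  have hadj : ∀ i, G.Adj (s i).2 (s (i + 1)).2 := fun i => (hnext _ _ (hsQ i)).2.1
  have hback : ∀ i, (s (i + 2)).2 ≠ (s i).2 := fun i => (hnext _ _ (hsQ (i + 1))).2.2
  -- A walk in the finite set `Q` that never backtracks revisits a vertex. The smallest gap `d`
  -- between equal vertices gives a cycle: gaps 1 and 2 would be a loop and a backtrack.
  have hex : ∃ d, 0 < d ∧ ∃ i, (s i).2 = (s (i + d)).2 := by
    obtain ⟨i, j, hij, h⟩ := Finite.exists_ne_map_eq_of_infinite fun i => (⟨(s i).2, hsQ i⟩ : Q)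
    have h := congrArg Subtype.val h
    rcases Nat.lt_or_gt_of_ne hij with hlt | hlt
    · exact ⟨j - i, by omega, i, by rwa [Nat.add_sub_of_le hlt.le]⟩
    · exact ⟨i - j, by omega, j, by rw [Nat.add_sub_of_le hlt.le]; exact h.symm⟩
  classical
  obtain ⟨hpos, i, hi⟩ := Nat.find_spec hex
  have hmin := fun d hd => Nat.find_min hex (m := d) hd
  generalize Nat.find hex = d at *
  have h1 : d ≠ 1 := by
    rintro rfl
    exact (hadj i).ne hi
  have h2 : d ≠ 2 := by
    rintro rfl
    exact hback i hi.symm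
  refine ⟨d, fun j => (s (i + j)).2, by omega, fun j _ => hsQ _, fun j hj l hl hjl => ?_,
    fun j _ => hadj _, ?_⟩
  · by_contra hne
    rcases Nat.lt_or_gt_of_ne hne with hlt | hlt
    · refine hmin (l - j) (by omega) ⟨by omega, i + j, ?_⟩
      rwa [show i + j + (l - j) = i + l by omega]
    · refine hmin (j - l) (by omega) ⟨by omega, i + l, ?_⟩
      rw [show i + l + (j - l) = i + j by omega]
      exact hjl.symm
  · have := hadj (i + (d - 1))
    rwa [show i + (d - 1) + 1 = i + d by omega, ← hi] at this

theorem IsCycleIn.of_chord {Q : Finset V} {n : ℕ} {f : ℕ → V} (h : IsCycleIn G Q n f) {i j : ℕ}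
    (hij : i + 1 < j) (hj : j < n) (hadj : G.Adj (f i) (f j)) :
    IsCycleIn G Q (j - i + 1) fun l => f (i + l) where
  three_le := by omega
  mem l hl := h.mem _ (by omega)
  inj l hl l' hl' hll := by
    have := h.inj _ (by omega) _ (by omega) hll
    omega
  adj l hl := h.adj (i + l) (by omega)
  closed := by
    simp only [Nat.add_sub_cancel, Nat.add_zero]
    rw [show i + (j - i) = j by omega]
    exact hadj.symm

/-- A shortest cycle is an induced cycle. -/
theorem exists_induced_cycle {Q : Finset V} (hQ : Q.Nonempty)
    (hdeg : ∀ x ∈ Q, ∀ a, ∃ b ∈ Q, G.Adj x b ∧ b ≠ a) :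
    ∃ (k : ℕ) (f : Fin (k + 3) → V), Function.Injective f ∧ (∀ i, f i ∈ Q) ∧
      (∀ i, G.Adj (f i) (f (i + 1))) ∧ ∀ i j, G.Adj (f i) (f j) → j = i + 1 ∨ i = j + 1 := by
  classical
  have hex := exists_isCycleIn hQ hdeg
  obtain ⟨f, hf⟩ := Nat.find_spec hex
  have hmin := fun d hd => Nat.find_min hex (m := d) hd
  generalize Nat.find hex = n at *
  obtain ⟨k, rfl⟩ : ∃ k, n = k + 3 := ⟨n - 3, by have := hf.three_le; omega⟩
  have key : ∀ i j : Fin (k + 3), i < j → G.Adj (f i) (f j) → j = i + 1 ∨ i = j + 1 := by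
    intro i j hij hadj
    by_cases h1 : (i : ℕ) + 1 = j
    · left
      ext
      rw [Fin.val_add_one_of_lt (hij.trans_le (Fin.le_last j)), h1]
    · right
      by_contra h2
      have hlt : (i : ℕ) < j := hij
      -- The cycle cut off by the chord is shorter unless the chord joins `0` to the last vertex,
      -- which is the closing edge.
      refine hmin (j - i + 1) ?_ ⟨_, hf.of_chord (by omega) j.2 hadj⟩
      by_contra h3
      have hi0 : i = 0 := Fin.ext (show (i : ℕ) = 0 by have := j.2; omega)
      have hjl : j = Fin.last (k + 2) := Fin.ext (show (j : ℕ) = k + 2 by have := j.2; omega)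
      exact h2 (by rw [hi0, hjl, Fin.last_add_one])
  refine ⟨k, fun i => f i, fun i j h => Fin.ext (hf.inj _ i.2 _ j.2 h), fun i => hf.mem _ i.2,
    fun i => ?_, fun i j h => ?_⟩
  · rcases eq_or_ne i (Fin.last (k + 2)) with rfl | h
    · simpa using hf.closed
    · have hlt := Fin.lt_last_iff_ne_last.2 h
      have hval := Fin.val_add_one_of_lt hlt
      simp only [hval]
      exact hf.adj _ (by omega)
  · rcases lt_trichotomy i j with hij | rfl | hij
    · exact key i j hij h
    · exact (G.loopless.irrefl _ h).elim
    · exact (key j i hij h.symm).symm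

theorem _root_.SimpleGraph.Connected.exists_adj_mem_notMem (hG : G.Connected) {T : Set V}
    (hT : T.Nonempty) (hT' : ∃ x, x ∉ T) : ∃ x ∉ T, ∃ y ∈ T, G.Adj x y := by
  obtain ⟨y, hy⟩ := hT
  obtain ⟨x, hx⟩ := hT'
  obtain ⟨w⟩ := hG.preconnected y x
  obtain ⟨d, -, h1, h2⟩ := w.exists_boundary_dart T hy hx
  exact ⟨d.snd, h2, d.fst, h1, d.adj.symm⟩

end InducedCycle

/-! ### Coloring the non-pendent vertices towards a root set, then the pendent ones. -/

section Main

variable {V : Type*} {C : Type*} [DecidableEq V] [DecidableEq C] {G : SimpleGraph V}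
  [G.LocallyFinite] {ℓ : V → V → Finset C} {D Q : Finset V} {φ : V → V → C}

/-- The root set `T` stays uncolored. A vertex `x` adjacent to `T` is colored after all of `Q`
outside `T ∪ {x}`, while its neighbor in `T` is still free. -/
theorem GoodOn.exists_union_sdiff (hdeg : ∀ v, G.degree v ≤ 3)
    (hℓ : ∀ u v, G.Adj u v → 6 ≤ (ℓ u v).card) (h : GoodOn G ℓ D φ) (hDQ : Disjoint D Q)
    (hQ3 : ∀ x ∈ Q, G.degree x = 3)
    (hcut : ∀ T ⊆ Q, T.Nonempty → T ≠ Q → ∃ x ∈ Q, x ∉ T ∧ ∃ y ∈ T, G.Adj x y)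
    (T : Finset V) (hTQ : T ⊆ Q) (hT : T.Nonempty) :
    ∃ ψ, GoodOn G ℓ (D ∪ Q \ T) ψ ∧ ∀ u ∈ D, ψ u = φ u := by
  induction hn : (Q \ T).card generalizing T with
  | zero =>
    have : Q \ T = ∅ := Finset.card_eq_zero.1 hn
    exact ⟨φ, by simpa [this] using h, fun _ _ => rfl⟩
  | succ n ih =>
    obtain ⟨x, hxQ, hxT, y, hyT, hxy⟩ := hcut T hTQ hT (by rintro rfl; simp at hn)
    have he : Q \ T = Insert.insert x (Q \ Insert.insert x T) := by grind
    have hxn : x ∉ Q \ Insert.insert x T := by simp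
    obtain ⟨ψ, hψ, hψD⟩ := ih (Insert.insert x T) (by grind) (by simp) (by
      rw [he, Finset.card_insert_of_notMem hxn] at hn
      omega)
    have hxD := Finset.disjoint_right.1 hDQ hxQ
    have hyD := Finset.disjoint_right.1 hDQ (hTQ hyT)
    obtain ⟨χ, hχ, hχD⟩ := hψ.exists_insert_of_degree_eq_three hdeg hℓ (x := x) (w := y)
      (by grind) (hQ3 x hxQ) hxy (by grind)
    refine ⟨χ, ?_, fun u hu => (hχD u (Finset.mem_union_left _ hu)).trans (hψD u hu)⟩
    rwa [he, Finset.union_insert]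

/-- The root is a single vertex with an uncolored neighbor outside `Q` if there is one. Otherwise
`hnbr` gives every vertex two neighbors in `Q`, and the root is an induced cycle. -/
theorem GoodOn.exists_union (hdeg : ∀ v, G.degree v ≤ 3)
    (hℓ : ∀ u v, G.Adj u v → 6 ≤ (ℓ u v).card) (h : GoodOn G ℓ D φ) (hDQ : Disjoint D Q)
    (hQ3 : ∀ x ∈ Q, G.degree x = 3)
    (hcut : ∀ T ⊆ Q, T.Nonempty → T ≠ Q → ∃ x ∈ Q, x ∉ T ∧ ∃ y ∈ T, G.Adj x y)
    (hnbr : ∀ x ∈ Q, (∃ y, y ∉ D ∧ y ∉ Q ∧ G.Adj x y) ∨ ∀ a, ∃ b ∈ Q, G.Adj x b ∧ b ≠ a) :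
    ∃ ψ, GoodOn G ℓ (D ∪ Q) ψ ∧ ∀ u ∈ D, ψ u = φ u := by
  rcases Q.eq_empty_or_nonempty with rfl | hQ
  · exact ⟨φ, by simpa using h, fun _ _ => rfl⟩
  by_cases hout : ∃ x ∈ Q, ∃ y, y ∉ D ∧ y ∉ Q ∧ G.Adj x y
  · obtain ⟨x, hx, y, hyD, hyQ, hxy⟩ := hout
    obtain ⟨ψ, hψ, hψD⟩ := h.exists_union_sdiff hdeg hℓ hDQ hQ3 hcut {x} (by simpa using hx)
      (by simp)
    have hxD := Finset.disjoint_right.1 hDQ hx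
    obtain ⟨χ, hχ, hχD⟩ := hψ.exists_insert_of_degree_eq_three hdeg hℓ (x := x) (w := y)
      (by simpa using hxD) (hQ3 x hx) hxy (by grind)
    refine ⟨χ, ?_, fun u hu => (hχD u (Finset.mem_union_left _ hu)).trans (hψD u hu)⟩
    have he : D ∪ Q = Insert.insert x (D ∪ Q \ {x}) := by grind
    rwa [he]
  · obtain ⟨k, f, hf, hfQ, hadj, hind⟩ := exists_induced_cycle hQ
      (fun x hx => (hnbr x hx).resolve_left fun hy => hout ⟨x, hx, hy⟩)
    have hsub : Finset.univ.image f ⊆ Q := by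
      intro x hx
      obtain ⟨i, -, rfl⟩ := Finset.mem_image.1 hx
      exact hfQ i
    obtain ⟨ψ, hψ, hψD⟩ := h.exists_union_sdiff hdeg hℓ hDQ hQ3 hcut _ hsub (by simp)
    obtain ⟨χ, hχ, hχD⟩ := hψ.exists_union_cycle hdeg hℓ hf (fun i => by
      have := Finset.disjoint_right.1 hDQ (hfQ i)
      simpa using this) (fun i => hQ3 _ (hfQ i)) hadj hind
    refine ⟨χ, ?_, fun u hu => (hχD u (Finset.mem_union_left _ hu)).trans (hψD u hu)⟩
    rwa [Finset.union_assoc, Finset.sdiff_union_of_subset hsub] at hχ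

theorem GoodOn.exists_union_of_degree_eq_one (hdeg : ∀ v, G.degree v ≤ 3)
    (hℓ : ∀ u v, G.Adj u v → 6 ≤ (ℓ u v).card) (h : GoodOn G ℓ D φ) (R : Finset V)
    (hR : ∀ x ∈ R, x ∉ D → G.degree x = 1) :
    ∃ ψ, GoodOn G ℓ (D ∪ R) ψ ∧ ∀ u ∈ D, ψ u = φ u := by
  induction R using Finset.induction_on with
  | empty => exact ⟨φ, by simpa using h, fun _ _ => rfl⟩
  | insert x R hx ih =>
    obtain ⟨ψ, hψ, hψD⟩ := ih fun y hy => hR y (Finset.mem_insert_of_mem hy)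
    by_cases hxD : x ∈ D
    · refine ⟨ψ, ?_, hψD⟩
      have he : D ∪ Insert.insert x R = D ∪ R := by grind
      rwa [he]
    · obtain ⟨χ, hχ, hχD⟩ := hψ.exists_insert_of_degree_eq_one hdeg hℓ (x := x) (by grind)
        (hR x (Finset.mem_insert_self _ _) hxD)
      refine ⟨χ, ?_, fun u hu => (hχD u (Finset.mem_union_left _ hu)).trans (hψD u hu)⟩
      rwa [Finset.union_insert]

/-- The initial coloring of the incidences at the two ends of a pendent edge. -/
theorem exists_goodOn_pair (hG : IsSemicubic G) (hℓ : ∀ u v, G.Adj u v → 6 ≤ (ℓ u v).card)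
    {u v : V} (huv : G.Adj u v) (hv : ∀ w, G.Adj v w → w = u) {c₁ c₂ : C} (h₁ : c₁ ∈ ℓ u v)
    (h₂ : c₂ ∈ ℓ v u) (hne : c₁ ≠ c₂) :
    ∃ φ, GoodOn G ℓ {u, v} φ ∧ φ u v = c₁ ∧ φ v u = c₂ := by
  let φ₀ : V → V → C := fun _ _ => c₂
  have hgood : GoodOn G ℓ {v} φ₀ := by
    refine ⟨?_, ?_, ?_⟩
    · intro x hx w hw
      obtain rfl := Finset.mem_singleton.1 hx
      obtain rfl := hv w hw
      exact h₂
    · intro x hx w w' hw hw' hww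
      obtain rfl := Finset.mem_singleton.1 hx
      exact (hww ((hv w hw).trans (hv w' hw').symm)).elim
    · intro x hx y hy hxy
      obtain rfl := Finset.mem_singleton.1 hx
      obtain rfl := Finset.mem_singleton.1 hy
      exact (G.loopless.irrefl _ hxy).elim
  suffices h : ∃ g : V → C, g v = c₁ ∧ (∀ w, G.Adj u w → g w ∈ ℓ u w) ∧
      (∀ w w', G.Adj u w → G.Adj u w' → w ≠ w' → g w ≠ g w') ∧ ∀ w, G.Adj u w → c₂ ≠ g w by
    obtain ⟨g, hgv, hg, hinj, hg₂⟩ := h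
    refine ⟨_, hgood.insert (x := u) (g := g) (by simpa using huv.ne) hg hinj
      (fun _ _ _ => hg₂) ?_, by simpa using hgv, ?_⟩
    · intro w hw _ w' _
      obtain rfl := Finset.mem_singleton.1 hw
      rw [hgv]
      exact hne
    · rw [Function.update_of_ne huv.ne']
  -- If `u` has degree 1 as well, the edge `uv` is a whole component.
  rcases hG u with hu | hu
  · obtain ⟨w, hw⟩ := Finset.card_eq_one.1 (hu : (G.neighborFinset u).card = 1)
    have hadj : ∀ x, G.Adj u x ↔ x = w := fun x => by
      rw [← G.mem_neighborFinset, hw, Finset.mem_singleton]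
    obtain rfl := (hadj v).1 huv
    refine ⟨fun _ => c₁, rfl, ?_, ?_, fun _ _ => hne.symm⟩
    · intro x hx
      obtain rfl := (hadj x).1 hx
      exact h₁
    · intro x y hx hy hxy
      exact (hxy (((hadj x).1 hx).trans ((hadj y).1 hy).symm)).elim
  · obtain ⟨a, b, hab, hav, hbv, hadj⟩ := exists_neighbors_of_degree_eq_three hu huv
    have hla := hℓ u a ((hadj a).2 (by simp))
    have hlb := hℓ u b ((hadj b).2 (by simp))
    obtain ⟨c, hc, hcn⟩ := Finset.exists_mem_notMem_of_card_lt_card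
      (s := {c₁, c₂}) (t := ℓ u a) (Finset.card_le_two.trans_lt (by omega))
    obtain ⟨d, hd, hdn⟩ := Finset.exists_mem_notMem_of_card_lt_card
      (s := {c₁, c₂, c}) (t := ℓ u b) (Finset.card_le_three.trans_lt (by omega))
    simp only [Finset.mem_insert, Finset.mem_singleton, not_or] at hcn hdn
    let g : V → C := fun w => if w = a then c else if w = b then d else c₁
    have ga : g a = c := by simp [g]
    have gb : g b = d := by simp [g, hab.symm]
    have gv : g v = c₁ := by simp [g, hav.symm, hbv.symm]
    refine ⟨g, gv, ?_, ?_, ?_⟩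
    · intro w hw
      obtain rfl | rfl | rfl := (hadj w).1 hw <;> simp_all only
    · intro w w' hw hw' hne
      obtain rfl | rfl | rfl := (hadj w).1 hw <;> obtain rfl | rfl | rfl := (hadj w').1 hw' <;>
        grind
    · intro w hw
      obtain rfl | rfl | rfl := (hadj w).1 hw <;> grind

end Main

theorem Incidence.exists_eq_mk {V : Type*} {G : SimpleGraph V} (a : Incidence G) :
    ∃ (u w : V) (h : G.Adj u w), a = ⟨u, s(u, w), h, Sym2.mem_mk_left u w⟩ := by
  obtain ⟨u, e, he, hu⟩ := a
  obtain ⟨w, rfl⟩ := hu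
  exact ⟨u, w, he, rfl⟩

/-! ### Use of the connectivity hypothesis and translation back to incidences. -/

section Pendent

variable {V : Type*} {C : Type*} [Fintype V] {G : SimpleGraph V} [DecidableRel G.Adj]

/-- Deleting from `G` its pendent vertices and one end of a pendent edge leaves a connected
graph. -/
theorem exists_adj_of_deletePendent
    (hdel : IsK1 (deletePendent G) ∨ IsTwoConnected (deletePendent G)) (u : V)
    {T : Finset V} (hT : T.Nonempty) (hTQ : ∀ x ∈ T, ¬IsPendentVertex G x ∧ x ≠ u)
    (hne : ∃ x ∉ T, ¬IsPendentVertex G x ∧ x ≠ u) :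
    ∃ x, (¬IsPendentVertex G x ∧ x ≠ u) ∧ x ∉ T ∧ ∃ y ∈ T, G.Adj x y := by
  obtain ⟨t, ht⟩ := hT
  obtain ⟨s, hsT, hs, hsu⟩ := hne
  have hst : s ≠ t := fun h => hsT (h ▸ ht)
  -- For `K₁` there is no room for both `s` and `t`. In the 2-connected case, connectedness suffices
  -- if `u` is pendent; otherwise the deletion of `u` is used.
  rcases hdel with ⟨⟨iso⟩⟩ | ⟨-, hconn, hconn'⟩
  · have h := iso.injective (Subsingleton.elim (iso ⟨s, hs⟩) (iso ⟨t, (hTQ t ht).1⟩))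
    exact (hst (congrArg Subtype.val h)).elim
  · by_cases hu : IsPendentVertex G u
    · obtain ⟨x, hx, y, hy, hxy⟩ := hconn.exists_adj_mem_notMem (T := {x | x.1 ∈ T})
        ⟨⟨t, (hTQ t ht).1⟩, ht⟩ ⟨⟨s, hs⟩, hsT⟩
      exact ⟨x, ⟨x.2, fun h => x.2 (h ▸ hu)⟩, hx, y, hy, hxy⟩
    · obtain ⟨x, hx, y, hy, hxy⟩ := (hconn' ⟨u, hu⟩).exists_adj_mem_notMem
        (T := {x | x.1.1 ∈ T})
        ⟨⟨⟨t, (hTQ t ht).1⟩, fun h => (hTQ t ht).2 (congrArg Subtype.val h)⟩, ht⟩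
        ⟨⟨⟨s, hs⟩, fun h => hsu (congrArg Subtype.val h)⟩, hsT⟩
      exact ⟨x.1, ⟨x.1.2, fun h => x.2 (Subtype.ext h)⟩, hx, y.1, hy, hxy⟩

theorem exists_goodOn_univ [DecidableEq V] [DecidableEq C] {ℓ : V → V → Finset C}
    (hG : IsSemicubic G)
    (hdel : IsK1 (deletePendent G) ∨ IsTwoConnected (deletePendent G))
    (hℓ : ∀ u v, G.Adj u v → 6 ≤ (ℓ u v).card)
    {u v : V} (huv : G.Adj u v) (hv : IsPendentVertex G v) {c₁ c₂ : C} (h₁ : c₁ ∈ ℓ u v)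
    (h₂ : c₂ ∈ ℓ v u) (hne : c₁ ≠ c₂) :
    ∃ φ, GoodOn G ℓ Finset.univ φ ∧ φ u v = c₁ ∧ φ v u = c₂ := by
  have hdeg : ∀ x, G.degree x ≤ 3 := fun x => by rcases hG x with h | h <;> omega
  have hvu : ∀ w, G.Adj v w → w = u := by
    obtain ⟨w, hw⟩ := Finset.card_eq_one.1 (hv : (G.neighborFinset v).card = 1)
    have hadj : ∀ x, G.Adj v x ↔ x = w := fun x => by
      rw [← G.mem_neighborFinset, hw, Finset.mem_singleton]
    exact fun x hx => ((hadj x).1 hx).trans ((hadj u).1 huv.symm).symm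
  obtain ⟨φ, hφ, e₁, e₂⟩ := exists_goodOn_pair hG hℓ huv hvu h₁ h₂ hne
  let Q : Finset V := Finset.univ.filter fun x => G.degree x ≠ 1 ∧ x ≠ u
  have hQ : ∀ x, x ∈ Q ↔ ¬IsPendentVertex G x ∧ x ≠ u := fun x => by simp [Q, IsPendentVertex]
  have hQ3 : ∀ x ∈ Q, G.degree x = 3 := fun x hx => (hG x).resolve_left ((hQ x).1 hx).1
  have hDQ : Disjoint {u, v} Q := by
    rw [Finset.disjoint_left]
    intro x hx hxQ
    rcases Finset.mem_insert.1 hx with rfl | hx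
    · exact ((hQ x).1 hxQ).2 rfl
    · obtain rfl := Finset.mem_singleton.1 hx
      exact ((hQ x).1 hxQ).1 hv
  obtain ⟨ψ, hψ, hψD⟩ := hφ.exists_union hdeg hℓ hDQ hQ3 (by
      intro T hTQ hT hTne
      obtain ⟨s, hsQ, hsT⟩ := Finset.exists_of_ssubset (hTQ.ssubset_of_ne hTne)
      obtain ⟨x, hx, h⟩ := exists_adj_of_deletePendent hdel u hT (fun x hx => (hQ x).1 (hTQ hx))
        ⟨s, hsT, (hQ s).1 hsQ⟩
      exact ⟨x, (hQ x).2 hx, h⟩) (by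
      intro x hx
      by_contra! hcon
      obtain ⟨hout, a, ha⟩ := hcon
      -- One of the three neighbors of `x` differs from `u` and `a`. It is not `v` either, whose
      -- only neighbor is `u`.
      obtain ⟨b, hb, hbn⟩ := Finset.exists_mem_notMem_of_card_lt_card
        (s := {u, a}) (t := G.neighborFinset x)
        (Finset.card_le_two.trans_lt (by have : (G.neighborFinset x).card = 3 := hQ3 x hx; omega))
      rw [SimpleGraph.mem_neighborFinset] at hb
      simp only [Finset.mem_insert, Finset.mem_singleton, not_or] at hbn
      have hbv : b ≠ v := by
        rintro rfl
        exact ((hQ x).1 hx).2 (hvu x hb.symm)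
      by_cases hbQ : b ∈ Q
      · exact hbn.2 (ha b hbQ hb)
      · exact hout b (by simp [hbn.1, hbv]) hbQ hb)
  obtain ⟨χ, hχ, hχD⟩ := hψ.exists_union_of_degree_eq_one hdeg hℓ Finset.univ (by
      intro x _ hx
      by_contra hx1
      have hxu : x ≠ u := fun h => hx (by simp [h])
      exact hx (Finset.mem_union_right _ ((hQ x).2 ⟨hx1, hxu⟩)))
  have hu : χ u = φ u := (hχD u (by simp)).trans (hψD u (by simp))
  have hv' : χ v = φ v := (hχD v (by simp)).trans (hψD v (by simp))
  rw [Finset.union_eq_right.2 (Finset.subset_univ _)] at hχ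
  exact ⟨χ, hχ, by rw [hu, e₁], by rw [hv', e₂]⟩

theorem exists_isListColoring (hG : IsSemicubic G)
    (hdel : IsK1 (deletePendent G) ∨ IsTwoConnected (deletePendent G))
    {L : Incidence G → Finset C} (hL : IsListAssignment G 6 L)
    {u v : V} (huv : G.Adj u v) (hv : IsPendentVertex G v) {a b : Incidence G}
    (ha : a = ⟨u, s(u, v), huv, Sym2.mem_mk_left u v⟩)
    (hb : b = ⟨v, s(v, u), huv.symm, Sym2.mem_mk_left v u⟩)
    {c₁ c₂ : C} (h₁ : c₁ ∈ L a) (h₂ : c₂ ∈ L b) (hne : c₁ ≠ c₂) :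
    ∃ φ : Incidence G → C, IsListColoring G L φ ∧ φ a = c₁ ∧ φ b = c₂ := by
  classical
  -- The empty list on non-adjacent pairs is never read, since every condition in `GoodOn` assumes
  -- adjacency.
  let ℓ : V → V → Finset C := fun x y =>
    if h : G.Adj x y then L ⟨x, s(x, y), h, Sym2.mem_mk_left x y⟩ else ∅
  have hℓ : ∀ x y (h : G.Adj x y), ℓ x y = L ⟨x, s(x, y), h, Sym2.mem_mk_left x y⟩ :=
    fun x y h => dif_pos h
  obtain ⟨ψ, hψ, e₁, e₂⟩ := exists_goodOn_univ (ℓ := ℓ) hG hdel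
    (fun x y h => by rw [hℓ x y h, hL]) huv hv (by rwa [hℓ u v huv, ← ha])
    (by rwa [hℓ v u huv.symm, ← hb]) hne
  let φ : Incidence G → C := fun i => ψ i.vertex (Sym2.Mem.other i.vertex_mem)
  have hφ : ∀ x y (h : G.Adj x y), φ ⟨x, s(x, y), h, Sym2.mem_mk_left x y⟩ = ψ x y := by
    intro x y h
    have := Sym2.other_spec (Sym2.mem_mk_left x y)
    exact congrArg (ψ x) (Sym2.congr_right.1 this)
  refine ⟨φ, ⟨?_, ?_⟩, by rw [ha, hφ, e₁], by rw [hb, hφ, e₂]⟩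
  · intro i j hij
    obtain ⟨x, w, hxw, rfl⟩ := i.exists_eq_mk
    obtain ⟨y, z, hyz, rfl⟩ := j.exists_eq_mk
    rw [hφ, hφ]
    obtain ⟨hne', h⟩ := hij
    have hio := fun p q => hψ.inout p (Finset.mem_univ p) q (Finset.mem_univ q)
    rcases h with h | h | h | h
    · obtain rfl : x = y := h
      exact hψ.inj x (Finset.mem_univ x) w z hxw hyz (by rintro rfl; exact hne' rfl)
    · rcases Sym2.eq_iff.1 h with ⟨rfl, rfl⟩ | ⟨rfl, rfl⟩
      · exact (hne' rfl).elim
      · exact hio x w hxw x hyz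
    · obtain rfl : y = w := Sym2.congr_right.1 h
      exact hio x y hxw z hyz
    · obtain rfl : x = z := Sym2.congr_right.1 (Sym2.eq_swap.trans h)
      exact (hio y x hyz w hxw).symm
  · intro i
    obtain ⟨x, w, hxw, rfl⟩ := i.exists_eq_mk
    rw [hφ, ← hℓ]
    exact hψ.mem x (Finset.mem_univ x) w hxw

end Pendent

end IncidenceColoring

theorem theorem2p2 {V : Type*} [Fintype V] {C : Type*}
    (G : SimpleGraph V) [DecidableRel G.Adj]
    (hG : IncidenceColoring.IsSemicubic G)
    (hpend : ∃ v : V, IncidenceColoring.IsPendentVertex G v)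
    (hdel : IncidenceColoring.IsK1 (IncidenceColoring.deletePendent G) ∨
      IncidenceColoring.IsTwoConnected (IncidenceColoring.deletePendent G))
    (L : IncidenceColoring.Incidence G → Finset C)
    (hL : IncidenceColoring.IsListAssignment G 6 L)
    (e : Sym2 V) (he : IncidenceColoring.IsPendentEdge G e) :
    IncidenceColoring.FreelyChoosable G L e := by
  obtain ⟨heG, p, hpe, hp⟩ := he
  refine ⟨heG, fun a b hae hbe hab c₁ h₁ c₂ h₂ hne => ?_⟩
  obtain ⟨u, w, huw, rfl⟩ := a.exists_eq_mk
  obtain ⟨v, z, hvz, rfl⟩ := b.exists_eq_mk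
  obtain rfl : s(u, w) = e := hae
  have hab : u ≠ v := hab
  rcases Sym2.eq_iff.1 (show s(v, z) = s(u, w) from hbe) with ⟨rfl, rfl⟩ | ⟨rfl, rfl⟩
  · exact (hab rfl).elim
  -- Either end may be the pendent one; in the first case the two incidences and their colors swap
  -- roles.
  rcases Sym2.mem_iff.1 hpe with rfl | rfl
  · obtain ⟨φ, hφ, e₁, e₂⟩ := IncidenceColoring.exists_isListColoring hG hdel hL hvz hp
      rfl rfl h₂ h₁ hne.symm
    exact ⟨φ, hφ, e₂, e₁⟩
  · exact IncidenceColoring.exists_isListColoring hG hdel hL huw hp rfl rfl h₁ h₂ hne
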